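/- Let $G=(N,A)$ be a finite directed graph (a road network). For every arc $a\in A$ let $X_a=(X_a(t))_{t\ge 0}$ be a right-continuous, time-homogeneous continuous-time Markov process on a finite state space $\mathcal S_a=\{1,\dots,n_a\}$ with transition rate matrix $Q_a$, and suppose that the processes $X_a$, $a\in A$, are independent. Put $B(t)=(X_a(t))_{a\in A}$, with state space $\mathcal I=\prod_{a\in A}\mathcal S_a$. Fix an arc $k\ell\in A$ and let $v_{k\ell}(s)>0$ be the speed on $k\ell$ when $B(t)=s\in\mathcal I$. For $d\ge 0$ and $s\in\mathcal I$ let $$\tau^s_{k\ell}(d)=\min\Big\{t\ge 0:\int_0^t v_{k\ell}(B(u))\,\mathrm du\ge d\Big\}\quad\text{given } B(0)=s$$ be the travel time over the distance $d$ on arc $k\ell$. For an integer $r\ge 0$ let $A^r_{k\ell}\subseteq A$ be the set of arcs at most $r$ arcs away from $k\ell$, including $k\ell$ itself; here two distinct arcs are one arc away from each other if they have an endpoint in common, and the distance between arcs is the length of a shortest chain of such steps. Assume local-$r$-correlation: $v_{k\ell}(s)=v_{k\ell}(s')$ whenever $s_a=s'_a$ for all $a\in A^r_{k\ell}$. Write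 $s^r_{k\ell}=(s_a)_{a\in A^r_{k\ell}}\in\mathcal I^r_{k\ell}=\prod_{a\in A^r_{k\ell}}\mathcal S_a$, and $v_{k\ell}(s)=v_{k\ell}(s^r_{k\ell})$. Let $V^r_{k\ell}$ be the diagonal matrix with entries $v_{k\ell}(\sigma)$, $\sigma\in\mathcal I^r_{k\ell}$, and let $Q^r_{k\ell}=\bigoplus_{a\in A^r_{k\ell}}Q_a$ be the Kronecker sum of the rate matrices of the arcs in $A^r_{k\ell}$. Then $Q^r_{k\ell}$ is the transition rate matrix of the Markov process $(X_a(t))_{a\in A^r_{k\ell}}$. For every $d\ge 0$ and $s\in\mathcal I$ the minimum defining $\tau^s_{k\ell}(d)$ is almost surely attained, its expectation is finite and depends on $s$ only through $s^r_{k\ell}$, and the vector $\Phi^r(d\,|\,k,\ell)=(\mathbb E[\tau^s_{k\ell}(d)])_{s^r_{k\ell}\in\mathcal I^r_{k\ell}}$ satisfies $$\begin{bmatrix}\Phi^r(d\,|\,k,\ell)\\ 1\end{bmatrix}=\exp\left\{\begin{bmatrix} d\,(V^r_{k\ell})^{-1}Q^r_{k\ell} & d\,(V^r_{k\ell})^{-1}\mathbf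 1\\ \mathbf 0^\top & 0\end{bmatrix}\right\}\begin{bmatrix}\mathbf 0\\ 1\end{bmatrix},$$ where $\mathbf 1$ and $\mathbf 0$ are the $|\mathcal I^r_{k\ell}|$-dimensional column vectors of ones and zeros. -/

import Mathlib

open MeasureTheory ProbabilityTheory Filter Topology
open scoped NNReal Matrix

namespace RoadNetwork

/-! ### The road network -/

/-- The directed arcs `kℓ` of the road network `G`, as pairs of nodes. -/
abbrev Arc {N : Type*} (G : Digraph N) : Type _ := {e : N × N // G.Adj e.1 e.2}

/-- Two distinct arcs are directly attached if they have an endpoint in common. -/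
def arcGraph {N : Type*} (G : Digraph N) : SimpleGraph (Arc G) :=
  SimpleGraph.fromRel fun a b =>
    a.1.1 = b.1.1 ∨ a.1.1 = b.1.2 ∨ a.1.2 = b.1.1 ∨ a.1.2 = b.1.2

open Classical in
/-- The set `A_{kℓ}^r` of the arcs that are at most `r` arcs away from the arc `e = kℓ`,
including `e` itself. The distance is the length of a shortest chain of directly attached arcs;
it is infinite if there is no such chain. -/
noncomputable def arcsWithin {N : Type*} [Fintype N] [DecidableEq N] (G : Digraph N)
    [DecidableRel G.Adj] (r : ℕ) (e : Arc G) : Finset (Arc G) :=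
  Finset.univ.filter fun a => (arcGraph G).edist e a ≤ (r : ℕ∞)

/-! ### Continuous-time Markov processes on a finite state space -/

/-- `Q` is a transition rate matrix: nonnegative off the diagonal, with zero row sums. -/
structure IsTransitionRateMatrix {S : Type*} [Fintype S] (Q : Matrix S S ℝ) : Prop where
  off_diag_nonneg : ∀ i j, i ≠ j → 0 ≤ Q i j
  row_sum : ∀ i, ∑ j, Q i j = 0

/-- Under `P`, the process `X` is a (right-continuous, time-homogeneous) continuous-time Markov
process on the finite set `S` with transition rate matrix `Q`. The Markov property is
`P(X(tₘ₊₁) = xₘ₊₁ | X(t₀) = x₀, …, X(tₘ) = xₘ) = [exp((tₘ₊₁ - tₘ) Q)]_{xₘ, xₘ₊₁}`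
for all `0 ≤ t₀ ≤ … ≤ tₘ₊₁`, with the conditional probability written as a quotient that is
multiplied out. There is no restriction on the law of `X(0)`. -/
structure IsMarkovProcess {Ω S : Type*} [MeasurableSpace Ω] [Fintype S] [DecidableEq S]
    [MeasurableSpace S] (Q : Matrix S S ℝ) (X : ℝ≥0 → Ω → S) (P : Measure Ω) : Prop where
  rate : IsTransitionRateMatrix Q
  measurable : ∀ t, Measurable (X t)
  right_continuous : ∀ᵐ ω ∂P, ∀ t, ∀ᶠ u in 𝓝[≥] t, X u ω = X t ω
  markov : ∀ (m : ℕ) (t : ℕ → ℝ≥0) (x : ℕ → S), Monotone t →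
    P.real {ω | ∀ i ≤ m + 1, X (t i) ω = x i} =
      P.real {ω | ∀ i ≤ m, X (t i) ω = x i} *
        (NormedSpace.exp (((t (m + 1) : ℝ) - (t m : ℝ)) • Q)) (x m) (x (m + 1))

/-- The Kronecker sum `⨁ₐ Qₐ = ∑ₐ I ⊗ ⋯ ⊗ Qₐ ⊗ ⋯ ⊗ I` of a finite family of square matrices, with
rows and columns indexed by the product of the individual index sets. -/
def kroneckerSum {ι : Type*} [Fintype ι] [DecidableEq ι] {n : ι → ℕ}
    (Q : ∀ a, Matrix (Fin (n a)) (Fin (n a)) ℝ) :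
    Matrix (∀ a, Fin (n a)) (∀ a, Fin (n a)) ℝ :=
  Matrix.of fun s s' => ∑ a, if ∀ b, b ≠ a → s b = s' b then Q a (s a) (s' a) else 0

/-! ### Travel times -/

/-- The durations after which a vehicle with speed `v (B u)` at time `u ≥ 0` has covered at least
the distance `d`. -/
def arrivalTimes {Ω S : Type*} (v : S → ℝ) (B : ℝ≥0 → Ω → S) (d : ℝ) (ω : Ω) : Set ℝ :=
  {t | 0 ≤ t ∧ d ≤ ∫ u in (0 : ℝ)..t, v (B u.toNNReal ω)}

/-- The travel time `τ(d) = min {t ≥ 0 : ∫₀ᵗ v(B(u)) du ≥ d}`. -/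
noncomputable def travelTime {Ω S : Type*} (v : S → ℝ) (B : ℝ≥0 → Ω → S) (d : ℝ) (ω : Ω) : ℝ :=
  sInf (arrivalTimes v B d ω)

/-- The block matrix `[[d V⁻¹ Q, d V⁻¹ 𝟏], [𝟎ᵀ, 0]]` with `V = diag v`. -/
noncomputable def blockMatrix {S : Type*} [Fintype S] [DecidableEq S] (Q : Matrix S S ℝ)
    (v : S → ℝ) (d : ℝ) : Matrix (S ⊕ Unit) (S ⊕ Unit) ℝ :=
  Matrix.fromBlocks
    (d • ((Matrix.diagonal v)⁻¹ * Q))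
    (d • ((Matrix.diagonal v)⁻¹ * (Matrix.of fun _ _ => 1 : Matrix S Unit ℝ)))
    0 0

/-! ### The local quantities -/

variable {N : Type*} [Fintype N] [DecidableEq N] {G : Digraph N} [DecidableRel G.Adj]

/-- The state `s_{kℓ}^r`: the truncation of the network state `s` to the arcs in `A_{kℓ}^r`. -/
noncomputable abbrev localState {n : Arc G → ℕ} (r : ℕ) (e : Arc G) (s : ∀ a, Fin (n a)) :
    ∀ a : arcsWithin G r e, Fin (n a) :=
  (arcsWithin G r e).restrict s

/-- The speed on the arc `e = kℓ` as a function of the local state: the value at `s_{kℓ}^r` is the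
speed at `s`, which does not depend on the choice of `s` if the speed depends only on the
states of the arcs in `A_{kℓ}^r`. -/
noncomputable def localSpeed {n : Arc G → ℕ} (r : ℕ) (e : Arc G)
    (v : (∀ a, Fin (n a)) → ℝ) : (∀ a : arcsWithin G r e, Fin (n a)) → ℝ :=
  Function.extend (localState r e) v 0

/-- The transition rate matrix `Q_{kℓ}^r` of the background process on the arcs in `A_{kℓ}^r`. -/
noncomputable def localRateMatrix {n : Arc G → ℕ} (r : ℕ) (e : Arc G)
    (Q : ∀ a, Matrix (Fin (n a)) (Fin (n a)) ℝ) :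
    Matrix (∀ a : arcsWithin G r e, Fin (n a)) (∀ a : arcsWithin G r e, Fin (n a)) ℝ :=
  kroneckerSum fun a : arcsWithin G r e => Q a

end RoadNetwork

/-! By independence, the arcs in $A^r_{k\ell}$ form a Markov process whose rate matrix is the
Kronecker sum (`isMarkovProcess_kroneckerSum`), and by locality the travel time is a functional of
that process alone. It remains to treat one finite-state process $B$ with rate matrix $Q$ and speed
$v$ (`IsMarkovProcess.travelTime_spec`).

The top entries $\varphi(s,x)$ of the last column of the block exponential solve $V\varphi' =
Q\varphi + \mathbf 1$, $\varphi(\cdot,0)=0$. Hence elapsed time plus $\varphi$(current state,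
remaining distance) should be a martingale until arrival: it starts at $\varphi(s,d)$ and ends at
$\tau$.

The argument is carried out on a time grid of mesh $h$, so only the finite-dimensional Markov
property is needed. One step changes the conditional mean of this quantity by $O(h^2)$
(`exists_eventually_abs_sum_exp_mul_le`), hence $O(1/h)$ steps by $O(h)$. Telescoping
(`abs_sum_gridIncrement_sub_le`) shows that the discrete travel time has mean tending to
$\varphi(s,d)$. Pathwise it tends to $\tau$ by right-continuity (`tendsto_mul_gridCount`), and
dominated convergence identifies the two limits. -/

namespace RoadNetwork

/-! ### Derivatives, expansion and uniqueness for the matrix exponential -/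

section MatrixExponential

open scoped Matrix.Norms.Operator

variable {S : Type*} [Fintype S] [DecidableEq S]

theorem hasDerivAt_exp_smul_apply (A : Matrix S S ℝ) (i j : S) (t : ℝ) :
    HasDerivAt (fun u : ℝ => NormedSpace.exp (u • A) i j)
      ((A * NormedSpace.exp (t • A)) i j) t :=
  (LinearMap.toContinuousLinearMap (Matrix.entryLinearMap ℝ ℝ i j)).hasFDerivAt.comp_hasDerivAt t
    (hasDerivAt_exp_smul_const' A t)

theorem hasDerivAt_exp_smul_apply_right (A : Matrix S S ℝ) (i j : S) (t : ℝ) :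
    HasDerivAt (fun u : ℝ => NormedSpace.exp (u • A) i j)
      ((NormedSpace.exp (t • A) * A) i j) t :=
  (LinearMap.toContinuousLinearMap (Matrix.entryLinearMap ℝ ℝ i j)).hasFDerivAt.comp_hasDerivAt t
    (hasDerivAt_exp_smul_const A t)

theorem exp_add_smul (A : Matrix S S ℝ) (a b : ℝ) :
    NormedSpace.exp ((a + b) • A) = NormedSpace.exp (a • A) * NormedSpace.exp (b • A) := by
  rw [add_smul]
  exact Matrix.exp_add_of_commute _ _ (((Commute.refl A).smul_left a).smul_right b)

/-- The bound is the power series remainder after two terms. The functional `L` will be a matrix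
entry. -/
theorem exists_eventually_abs_clm_exp_smul_sub_le {𝔸 : Type*} [NormedRing 𝔸] [NormedAlgebra ℝ 𝔸]
    [CompleteSpace 𝔸] (L : 𝔸 →L[ℝ] ℝ) (A : 𝔸) :
    ∃ C, 0 ≤ C ∧ ∀ᶠ h in 𝓝 (0 : ℝ),
      |L (NormedSpace.exp (h • A) - (1 + h • A))| ≤ C * h ^ 2 := by
  have h1 := (NormedSpace.exp_hasFPowerSeriesAt_zero (𝕂 := ℝ) (𝔸 := 𝔸)).isBigO_sub_partialSum_pow 2
  have h2 : Tendsto (fun h : ℝ => h • A) (𝓝 0) (𝓝 0) := by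
    have : Continuous (fun h : ℝ => h • A) := by fun_prop
    simpa using this.tendsto 0
  obtain ⟨C, hC, h3⟩ := (h1.comp_tendsto h2).exists_nonneg
  refine ⟨‖L‖ * (C * ‖A‖ ^ 2), by positivity, ?_⟩
  filter_upwards [h3.bound] with h hh
  have h4 := L.le_opNorm (NormedSpace.exp (h • A) - (1 + h • A))
  have h5 : ‖NormedSpace.exp (h • A) - (1 + h • A)‖ ≤ C * (|h| * ‖A‖) ^ 2 := by
    simpa [FormalMultilinearSeries.partialSum, Finset.sum_range_succ,
      NormedSpace.expSeries_apply_eq, norm_smul] using hh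
  calc _ ≤ ‖L‖ * (C * (|h| * ‖A‖) ^ 2) := h4.trans (by gcongr)
    _ = _ := by rw [mul_pow, sq_abs]; ring

/-- A uniform second-order expansion of the matrix exponential at `0`. -/
theorem exists_eventually_abs_exp_smul_sub_le (A : Matrix S S ℝ) :
    ∃ C, 0 ≤ C ∧ ∀ᶠ h in 𝓝 (0 : ℝ), ∀ i j,
      |NormedSpace.exp (h • A) i j - (1 + h • A) i j| ≤ C * h ^ 2 := by
  have key (i j : S) : ∃ C, 0 ≤ C ∧ ∀ᶠ h in 𝓝 (0 : ℝ),
      |NormedSpace.exp (h • A) i j - (1 + h • A) i j| ≤ C * h ^ 2 :=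
    exists_eventually_abs_clm_exp_smul_sub_le
      (LinearMap.toContinuousLinearMap (Matrix.entryLinearMap ℝ ℝ i j)) A
  choose C hC hC' using key
  refine ⟨∑ i, ∑ j, C i j, Finset.sum_nonneg fun i _ => Finset.sum_nonneg fun j _ => hC i j, ?_⟩
  filter_upwards [eventually_all.2 fun i => eventually_all.2 fun j => hC' i j] with h hh i j
  refine (hh i j).trans ?_
  gcongr
  calc C i j ≤ ∑ j, C i j := Finset.single_le_sum (fun j _ => hC i j) (Finset.mem_univ j)
    _ ≤ _ := Finset.single_le_sum (f := fun i => ∑ j, C i j)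
      (fun i _ => Finset.sum_nonneg fun j _ => hC i j) (Finset.mem_univ i)

/-- A matrix-valued curve solving `F' = A F`, `F 0 = 1` is the exponential. -/
theorem eq_exp_smul_of_hasDerivAt (A : Matrix S S ℝ) (F : ℝ → Matrix S S ℝ) (h0 : F 0 = 1)
    (hF : ∀ t i j, HasDerivAt (fun u => F u i j) ((A * F t) i j) t) (t : ℝ) :
    F t = NormedSpace.exp (t • A) := by
  have hneg (i j : S) (t : ℝ) : HasDerivAt (fun u : ℝ => NormedSpace.exp ((-u) • A) i j)
      (-(NormedSpace.exp ((-t) • A) * A) i j) t := by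
    simpa [Function.comp_def] using
      (hasDerivAt_exp_smul_apply_right A i j (-t)).scomp t (hasDerivAt_neg t)
  -- The two terms of the product rule, `-exp(-tA) A F` and `exp(-tA) (A F)`, cancel.
  have hprod (i j : S) (t : ℝ) :
      HasDerivAt (fun u : ℝ => (NormedSpace.exp ((-u) • A) * F u) i j) 0 t := by
    simp only [Matrix.mul_apply]
    refine (HasDerivAt.fun_sum (u := Finset.univ)
      fun k _ => (hneg i k t).mul (hF t k j)).congr_deriv ?_
    simp only [Finset.sum_add_distrib, neg_mul, Finset.sum_neg_distrib]
    have := congrFun₂ (Matrix.mul_assoc (NormedSpace.exp ((-t) • A)) A (F t)) i j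
    rw [Matrix.mul_apply, Matrix.mul_apply] at this
    linarith
  have hone : NormedSpace.exp ((-t) • A) * F t = 1 := by
    ext i j
    have := is_const_of_deriv_eq_zero (fun u => (hprod i j u).differentiableAt)
      (fun u => (hprod i j u).deriv) t 0
    simpa [h0] using this
  have hinv : NormedSpace.exp (t • A) * NormedSpace.exp ((-t) • A) = 1 := by
    rw [← exp_add_smul]; simp
  calc F t = NormedSpace.exp (t • A) * NormedSpace.exp ((-t) • A) * F t := by rw [hinv, one_mul]
    _ = _ := by rw [Matrix.mul_assoc, hone, mul_one]

end MatrixExponential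

/-! ### Kronecker sums and their exponentials -/

section KroneckerSum

variable {ι : Type*} [Fintype ι] [DecidableEq ι] {n : ι → ℕ}

/-- The summand of `a` in row `s` is supported on the states that agree with `s` off `a`, and
`Function.update s a` parametrises them. -/
theorem sum_kroneckerSum_mul (Q : ∀ a, Matrix (Fin (n a)) (Fin (n a)) ℝ) (s : ∀ a, Fin (n a))
    (f : (∀ a, Fin (n a)) → ℝ) :
    ∑ u, kroneckerSum Q s u * f u = ∑ a, ∑ j, Q a (s a) j * f (Function.update s a j) := by
  simp only [kroneckerSum, Matrix.of_apply, Finset.sum_mul]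
  rw [Finset.sum_comm]
  refine Finset.sum_congr rfl fun a _ => ?_
  symm
  refine Finset.sum_of_injOn (Function.update s a)
    (Function.update_injective s a).injOn (fun _ _ => Finset.mem_coe.2 (Finset.mem_univ _)) ?_ ?_
  · intro u _ hu
    rw [if_neg, zero_mul]
    intro h
    refine hu ⟨u a, by simp, ?_⟩
    ext b
    by_cases hb : b = a
    · subst hb; simp
    · simp [hb, h b hb]
  · intro j _
    rw [if_pos (fun b hb => by simp [hb])]
    simp

theorem isTransitionRateMatrix_kroneckerSum {Q : ∀ a, Matrix (Fin (n a)) (Fin (n a)) ℝ}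
    (hQ : ∀ a, IsTransitionRateMatrix (Q a)) : IsTransitionRateMatrix (kroneckerSum Q) where
  off_diag_nonneg s s' hs := by
    refine Finset.sum_nonneg fun a _ => ?_
    split_ifs with h
    · refine (hQ a).off_diag_nonneg _ _ fun ha => hs ?_
      ext b
      by_cases hb : b = a
      · subst hb; rw [ha]
      · rw [h b hb]
    · exact le_rfl
  row_sum s := by
    have := sum_kroneckerSum_mul Q s (fun _ => 1)
    simpa [(hQ _).row_sum] using this

/-- By the product rule, the product on the right solves the linear equation that characterises the
exponential on the left. -/
theorem exp_smul_kroneckerSum_apply (Q : ∀ a, Matrix (Fin (n a)) (Fin (n a)) ℝ) (t : ℝ)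
    (s s' : ∀ a, Fin (n a)) :
    NormedSpace.exp (t • kroneckerSum Q) s s' =
      ∏ a, NormedSpace.exp (t • Q a) (s a) (s' a) := by
  have := eq_exp_smul_of_hasDerivAt (kroneckerSum Q)
    (fun t => Matrix.of fun s s' => ∏ a, NormedSpace.exp (t • Q a) (s a) (s' a)) ?_ ?_ t
  · rw [← this, Matrix.of_apply]
  · ext s s'
    simp only [zero_smul, NormedSpace.exp_zero, Matrix.of_apply, Matrix.one_apply]
    by_cases h : s = s'
    · simp [h]
    · obtain ⟨a, ha⟩ := Function.ne_iff.1 h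
      rw [if_neg h]
      exact Finset.prod_eq_zero (Finset.mem_univ a) (if_neg ha)
  · intro t s s'
    simp only [Matrix.of_apply, Matrix.mul_apply, sum_kroneckerSum_mul]
    refine (HasDerivAt.fun_finsetProd (u := Finset.univ)
      fun a _ => hasDerivAt_exp_smul_apply (Q a) (s a) (s' a) t).congr_deriv ?_
    refine Finset.sum_congr rfl fun a _ => ?_
    rw [Matrix.mul_apply, smul_eq_mul, Finset.mul_sum]
    refine Finset.sum_congr rfl fun j _ => ?_
    rw [← Finset.mul_prod_erase _ _ (Finset.mem_univ a), Function.update_self]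
    have : ∀ b ∈ Finset.univ.erase a, NormedSpace.exp (t • Q b) (Function.update s a j b) (s' b) =
        NormedSpace.exp (t • Q b) (s b) (s' b) :=
      fun b hb => by rw [Function.update_of_ne (Finset.ne_of_mem_erase hb)]
    rw [Finset.prod_congr rfl this]
    ring

end KroneckerSum

/-! ### Superposition of independent Markov processes -/

section Independent

variable {ι : Type*} [Fintype ι] [DecidableEq ι] {n : ι → ℕ} {Ω : Type*} [MeasurableSpace Ω]

/-- Independent Markov processes form a Markov process whose rate matrix is the Kronecker sum. -/
theorem isMarkovProcess_kroneckerSum {Q : ∀ a, Matrix (Fin (n a)) (Fin (n a)) ℝ}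
    {X : ∀ a : ι, ℝ≥0 → Ω → Fin (n a)} {P : Measure Ω}
    (hX : ∀ a, IsMarkovProcess (Q a) (X a) P)
    (hindep : iIndepFun (fun a ω t => X a t ω) P) :
    IsMarkovProcess (kroneckerSum Q) (fun t ω a => X a t ω) P where
  rate := isTransitionRateMatrix_kroneckerSum fun a => (hX a).rate
  measurable t := measurable_pi_iff.2 fun a => (hX a).measurable t
  right_continuous := by
    filter_upwards [eventually_all.2 fun a => (hX a).right_continuous] with ω hω t
    filter_upwards [eventually_all.2 fun a => hω a t] with u hu
    exact funext hu
  markov m t x ht := by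
    have hprod (k : ℕ) : P.real {ω | ∀ i ≤ k, (fun a => X a (t i) ω) = x i} =
        ∏ a, P.real {ω | ∀ i ≤ k, X a (t i) ω = x i a} := by
      have h := hindep.measure_inter_preimage_eq_mul Finset.univ
        (sets := fun a => {p | ∀ i ≤ k, p (t i) = x i a}) (fun a _ => by
          simp only [Set.ofPred_forall]
          exact MeasurableSet.iInter fun i => MeasurableSet.iInter fun _ =>
            measurableSet_eq_fun (measurable_pi_apply (t i)) measurable_const)
      have hset : {ω | ∀ i ≤ k, (fun a => X a (t i) ω) = x i} =
          ⋂ a ∈ Finset.univ, (fun ω t => X a t ω) ⁻¹' {p | ∀ i ≤ k, p (t i) = x i a} := by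
        ext ω
        simp only [funext_iff, Set.mem_ofPred_eq, Finset.mem_univ, Set.iInter_true, Set.mem_iInter,
          Set.mem_preimage]
        exact ⟨fun h a i hi => h i hi a, fun h i hi a => h a i hi⟩
      rw [measureReal_def, hset, h, ENNReal.toReal_prod]
      rfl
    rw [hprod, hprod, exp_smul_kroneckerSum_apply, ← Finset.prod_mul_distrib]
    exact Finset.prod_congr rfl fun a _ => (hX a).markov m t (fun i => x i a) ht

end Independent

/-! ### Counting grid points before arrival -/

section GridCount

/-- Since `D` grows at rate at least `m`, an error `ε + h * M` in distance costs at most `(ε + h *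
M) / m` in time; rounding to the grid costs at most another `h`. -/
theorem abs_mul_card_filter_sub_le {D : ℝ → ℝ} {x : ℕ → ℝ} {m M h d τ ε : ℝ} {n : ℕ}
    (hm : 0 < m) (hM : 0 ≤ M) (hh : 0 < h) (hε : 0 ≤ ε)
    (hD : ∀ s t, 0 ≤ s → s ≤ t → m * (t - s) ≤ D t - D s) (hτ0 : 0 ≤ τ) (hτn : τ ≤ n * h)
    (hτ : D τ = d) (hx : ∀ k ≤ n, |x k - D (k * h)| ≤ ε) :
    |h * ((Finset.range n).filter fun k => x k ≤ d - h * M).card - τ| ≤ (ε + h * M) / m + h := by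
  have hmul (k : ℕ) : 0 ≤ k * h := by positivity
  have hhM : 0 ≤ h * M := by positivity
  rw [abs_le]
  constructor
  · have hsub : Finset.range ⌈(τ - (ε + h * M) / m) / h⌉₊ ⊆
        (Finset.range n).filter fun k => x k ≤ d - h * M := by
      intro k hk
      have hk1 : k * h < τ - (ε + h * M) / m := by
        have := Nat.lt_ceil.1 (Finset.mem_range.1 hk)
        rwa [lt_div_iff₀ hh] at this
      have hpos : 0 ≤ (ε + h * M) / m := by positivity
      have hkn : k < n := by
        have : (k : ℝ) * h < n * h := by linarith
        exact_mod_cast lt_of_mul_lt_mul_right this hh.le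
      have h1 := hD (k * h) τ (hmul k) (by linarith)
      have h2 := (abs_le.1 (hx k hkn.le)).2
      have h3 : ε + h * M ≤ m * (τ - k * h) := by
        have : (ε + h * M) / m ≤ τ - k * h := by linarith
        rwa [div_le_iff₀' hm] at this
      exact Finset.mem_filter.2 ⟨Finset.mem_range.2 hkn, by linarith⟩
    have hcard := Finset.card_le_card hsub
    rw [Finset.card_range] at hcard
    have h1 := (Nat.le_ceil ((τ - (ε + h * M) / m) / h)).trans (Nat.cast_le.2 hcard)
    rw [div_le_iff₀' hh] at h1
    linarith
  · have hsub : ((Finset.range n).filter fun k => x k ≤ d - h * M) ⊆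
        Finset.range (⌊(τ + ε / m) / h⌋₊ + 1) := by
      intro k hk
      obtain ⟨hkn, hk⟩ := Finset.mem_filter.1 hk
      have hkn := Finset.mem_range.1 hkn
      have h2 := (abs_le.1 (hx k hkn.le)).1
      have h3 : k * h ≤ τ + ε / m := by
        rcases le_total (k * h) τ with h4 | h4
        · have : 0 ≤ ε / m := by positivity
          linarith
        · have h1 := hD τ (k * h) hτ0 h4
          have : k * h - τ ≤ ε / m := by
            rw [le_div_iff₀' hm]
            linarith
          linarith
      rw [Finset.mem_range, Nat.lt_succ_iff]
      exact Nat.le_floor ((le_div_iff₀ hh).2 h3)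
    have hcard := Finset.card_le_card hsub
    rw [Finset.card_range] at hcard
    have hpos : 0 ≤ (τ + ε / m) / h := by positivity
    have h1 : (((Finset.range n).filter fun k => x k ≤ d - h * M).card : ℝ) ≤
        (τ + ε / m) / h + 1 := by
      refine (Nat.cast_le.2 hcard).trans ?_
      push_cast
      linarith [Nat.floor_le hpos]
    have h2 := mul_le_mul_of_nonneg_left h1 hh.le
    rw [mul_add, mul_div_cancel₀ _ hh.ne'] at h2
    have h3 : 0 ≤ h * M / m := by positivity
    rw [add_div]
    linarith

end GridCount

/-! ### Pathwise approximation of the travel time -/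

section RightContinuous

/-- Rounding up approaches `u` from the right, the side on which the paths are continuous. This is
why the grid speed is read at right endpoints. -/
theorem tendsto_ceil_div_mul (u : ℝ≥0) {h : ℕ → ℝ≥0} (hpos : ∀ n, 0 < h n)
    (hlim : Tendsto h atTop (𝓝 0)) :
    Tendsto (fun n => (⌈u / h n⌉₊ : ℝ≥0) * h n) atTop (𝓝[≥] u) := by
  have hle (n : ℕ) : u ≤ (⌈u / h n⌉₊ : ℝ≥0) * h n :=
    (div_le_iff₀ (hpos n)).1 (Nat.le_ceil _)
  refine tendsto_nhdsWithin_iff.2 ⟨?_, Eventually.of_forall hle⟩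
  refine tendsto_of_tendsto_of_tendsto_of_le_of_le tendsto_const_nhds
    (h := fun n => u + h n) (by simpa using tendsto_const_nhds.add hlim) hle fun n => ?_
  have := (Nat.ceil_lt_add_one (zero_le (a := u / h n))).le
  calc (⌈u / h n⌉₊ : ℝ≥0) * h n ≤ (u / h n + 1) * h n := by gcongr
    _ = u + h n := by rw [add_mul, div_mul_cancel₀ _ (hpos n).ne', one_mul]

variable {S : Type*} {v : S → ℝ} {b : ℝ≥0 → S}

/-- The speed along the path `b` at time `u`. -/
def pathSpeed (v : S → ℝ) (b : ℝ≥0 → S) (u : ℝ) : ℝ := v (b u.toNNReal)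

/-- The speed at the first point of the grid with mesh `h` that is not before `u`. -/
noncomputable def gridSpeed (v : S → ℝ) (b : ℝ≥0 → S) (h : ℝ≥0) (u : ℝ) : ℝ :=
  v (b (⌈u.toNNReal / h⌉₊ * h))

theorem measurable_gridSpeed (v : S → ℝ) (b : ℝ≥0 → S) (h : ℝ≥0) :
    Measurable (gridSpeed v b h) := by
  have : Measurable fun u : ℝ => ⌈u.toNNReal / h⌉₊ :=
    Nat.measurable_ceil.comp (measurable_real_toNNReal.div_const h)
  exact (measurable_of_countable fun k : ℕ => v (b (k * h))).comp this

theorem tendsto_gridSpeed (v : S → ℝ) (hb : ∀ t, ∀ᶠ u in 𝓝[≥] t, b u = b t) {h : ℕ → ℝ≥0}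
    (hpos : ∀ n, 0 < h n) (hlim : Tendsto h atTop (𝓝 0)) (u : ℝ) :
    Tendsto (fun n => gridSpeed v b (h n) u) atTop (𝓝 (pathSpeed v b u)) := by
  refine tendsto_const_nhds.congr' ?_
  filter_upwards [(tendsto_ceil_div_mul u.toNNReal hpos hlim).eventually (hb u.toNNReal)] with n hn
  rw [gridSpeed, hn, pathSpeed]

theorem measurable_pathSpeed (v : S → ℝ) (hb : ∀ t, ∀ᶠ u in 𝓝[≥] t, b u = b t) :
    Measurable (pathSpeed v b) := by
  have hlim : Tendsto (fun n : ℕ => (1 : ℝ≥0) / (n + 1)) atTop (𝓝 0) :=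
    tendsto_one_div_add_atTop_nhds_zero_nat
  exact measurable_of_tendsto_metrizable (fun n => measurable_gridSpeed v b _)
    (tendsto_pi_nhds.2 fun u => tendsto_gridSpeed v hb (fun n => by positivity) hlim u)

theorem intervalIntegrable_of_measurable_of_mem_Icc {f : ℝ → ℝ} {m M : ℝ} (hf : Measurable f)
    (hfm : ∀ u, f u ∈ Set.Icc m M) (s t : ℝ) : IntervalIntegrable f volume s t := by
  refine (intervalIntegrable_const (c := max |m| |M|)).mono_fun hf.aestronglyMeasurable
    (Eventually.of_forall fun u => ?_)
  dsimp only
  rw [Real.norm_eq_abs, Real.norm_eq_abs, abs_of_nonneg (le_max_of_le_left (abs_nonneg m))]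
  exact abs_le_max_abs_abs (hfm u).1 (hfm u).2

variable {m M : ℝ}

theorem mul_sub_le_integral_sub {f : ℝ → ℝ} (hf : Measurable f) (hfm : ∀ u, f u ∈ Set.Icc m M)
    {s t : ℝ} (hst : s ≤ t) :
    m * (t - s) ≤ (∫ u in (0 : ℝ)..t, f u) - ∫ u in (0 : ℝ)..s, f u := by
  have hint := intervalIntegrable_of_measurable_of_mem_Icc hf hfm
  rw [intervalIntegral.integral_interval_sub_left (hint _ _) (hint _ _)]
  have := intervalIntegral.integral_mono_on hst (intervalIntegrable_const (c := m)) (hint s t)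
    fun u _ => (hfm u).1
  rw [intervalIntegral.integral_const, smul_eq_mul] at this
  linarith

/-- The travel time is attained: it is the unique time at which the distance `d` is covered. -/
theorem isLeast_travelTime_and_integral_eq {Ω : Type*} {B : ℝ≥0 → Ω → S} {ω : Ω} {d : ℝ}
    (hm : 0 < m) (hv : ∀ s, v s ∈ Set.Icc m M) (hb : ∀ t, ∀ᶠ u in 𝓝[≥] t, B u ω = B t ω)
    (hd : 0 ≤ d) :
    IsLeast (arrivalTimes v B d ω) (travelTime v B d ω) ∧ travelTime v B d ω ≤ d / m ∧
      ∫ u in (0 : ℝ)..travelTime v B d ω, pathSpeed v (fun t => B t ω) u = d := by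
  have hmeas := measurable_pathSpeed (b := fun t => B t ω) v hb
  have hmem (u : ℝ) : pathSpeed v (fun t => B t ω) u ∈ Set.Icc m M := hv _
  have hint := intervalIntegrable_of_measurable_of_mem_Icc hmeas hmem
  have hinc {s t : ℝ} (hst : s ≤ t) := mul_sub_le_integral_sub hmeas hmem hst
  have hcont : Continuous fun t => ∫ u in (0 : ℝ)..t, pathSpeed v (fun t => B t ω) u :=
    intervalIntegral.continuous_primitive hint 0
  have hdm : 0 ≤ d / m := by positivity
  have hend : d ≤ ∫ u in (0 : ℝ)..(d / m), pathSpeed v (fun t => B t ω) u := by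
    have := hinc hdm
    rw [intervalIntegral.integral_same, sub_zero, sub_zero, mul_div_cancel₀ _ hm.ne'] at this
    exact this
  -- Speed at least `m` covers `d` by time `d / m`, and the distance is continuous in time.
  obtain ⟨τ, hτ, hτd⟩ := intermediate_value_Icc hdm hcont.continuousOn
    (show d ∈ Set.Icc _ _ from ⟨by simpa using hd, hend⟩)
  have hleast : IsLeast (arrivalTimes v B d ω) τ := by
    refine ⟨⟨hτ.1, hτd.ge⟩, fun t ht => ?_⟩
    by_contra! hlt
    have h1 := hinc hlt.le
    have h2 : 0 < m * (τ - t) := mul_pos hm (sub_pos.2 hlt)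
    have h3 : d ≤ ∫ u in (0 : ℝ)..t, pathSpeed v (fun t => B t ω) u := ht.2
    dsimp only at hτd
    linarith
  have heq : travelTime v B d ω = τ := hleast.csInf_eq
  rw [heq]
  exact ⟨hleast, hτ.2, hτd⟩

theorem gridSpeed_eq_of_mem_Ioc (v : S → ℝ) (b : ℝ≥0 → S) {h : ℝ≥0} (hh : 0 < h) (j : ℕ) {u : ℝ}
    (hu : u ∈ Set.Ioc (j * h : ℝ) ((j + 1 : ℕ) * h)) :
    gridSpeed v b h u = v (b ((j + 1 : ℕ) * h)) := by
  have hceil : ⌈u.toNNReal / h⌉₊ = j + 1 := by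
    rw [Nat.ceil_eq_iff (Nat.succ_ne_zero j), Nat.succ_sub_one, lt_div_iff₀ hh, div_le_iff₀ hh]
    constructor
    · rw [Real.lt_toNNReal_iff_coe_lt]
      exact_mod_cast hu.1
    · rw [Real.toNNReal_le_iff_le_coe]
      exact_mod_cast hu.2
  rw [gridSpeed, hceil]

/-- The distance covered up to the `k`-th grid point with the speed at the right end of each
grid interval. -/
def gridDistance (v : S → ℝ) (h : ℝ) (c : ℕ → S) (k : ℕ) : ℝ :=
  ∑ j ∈ Finset.range k, h * v (c (j + 1))

theorem integral_gridSpeed (hv : ∀ s, v s ∈ Set.Icc m M) (b : ℝ≥0 → S) {h : ℝ≥0} (hh : 0 < h)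
    (k : ℕ) : ∫ u in (0 : ℝ)..(k * h), gridSpeed v b h u =
      gridDistance v h (fun i => b (i * h)) k := by
  have hint := intervalIntegrable_of_measurable_of_mem_Icc (measurable_gridSpeed v b h)
    (fun _ => hv _)
  have := intervalIntegral.sum_integral_adjacent_intervals (a := fun i : ℕ => (i * h : ℝ))
    (n := k) (μ := volume) (f := gridSpeed v b h) fun _ _ => hint _ _
  simp only [Nat.cast_zero, zero_mul] at this
  rw [← this, gridDistance]
  refine Finset.sum_congr rfl fun j _ => ?_
  have hle : (j * h : ℝ) ≤ (j + 1 : ℕ) * h := by push_cast; nlinarith [h.2]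
  rw [intervalIntegral.integral_congr_ae (g := fun _ => v (b ((j + 1 : ℕ) * h)))
    (Eventually.of_forall fun u hu => gridSpeed_eq_of_mem_Ioc v b hh j
      (by rwa [Set.uIoc_of_le hle] at hu)), intervalIntegral.integral_const, smul_eq_mul]
  push_cast
  ring

/-- The number of grid points among the first `n` before which less than (almost) the distance `d`
has been covered. -/
noncomputable def gridCount (v : S → ℝ) (M d : ℝ) (n : ℕ) (h : ℝ) (c : ℕ → S) : ℕ :=
  ((Finset.range n).filter fun k => gridDistance v h c k ≤ d - h * M).card

/-- The travel time is the limit of the travel times of the grid approximations. -/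
theorem tendsto_mul_gridCount {Ω : Type*} {B : ℝ≥0 → Ω → S} {ω : Ω} {d : ℝ} {T : ℝ≥0}
    (hm : 0 < m) (hv : ∀ s, v s ∈ Set.Icc m M) (hb : ∀ t, ∀ᶠ u in 𝓝[≥] t, B u ω = B t ω)
    (hd : 0 ≤ d) (hT : 0 < T) (hdT : d / m ≤ T) :
    Tendsto (fun n : ℕ => (T / (n + 1 : ℕ) : ℝ) * gridCount v M d (n + 1) (T / (n + 1 : ℕ))
      (fun i => B (i * (T / (n + 1 : ℕ))) ω)) atTop (𝓝 (travelTime v B d ω)) := by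
  obtain ⟨hleast, hle, heq⟩ := isLeast_travelTime_and_integral_eq hm hv hb hd
  set τ := travelTime v B d ω
  set b : ℝ≥0 → S := fun t => B t ω
  replace hb : ∀ t, ∀ᶠ u in 𝓝[≥] t, b u = b t := hb
  have hM : 0 ≤ M := hm.le.trans ((hv (b 0)).1.trans (hv (b 0)).2)
  let h : ℕ → ℝ≥0 := fun n => T / (n + 1 : ℕ)
  have hpos (n : ℕ) : 0 < h n := by positivity
  have hlim : Tendsto h atTop (𝓝 0) :=
    (tendsto_const_div_atTop_nhds_zero_nat T).comp (tendsto_add_atTop_nat 1)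
  have hmeas := measurable_pathSpeed v hb
  have hmem (u : ℝ) : pathSpeed v b u ∈ Set.Icc m M := hv _
  have hint := intervalIntegrable_of_measurable_of_mem_Icc hmeas hmem
  have hgint (n : ℕ) := intervalIntegrable_of_measurable_of_mem_Icc
    (measurable_gridSpeed v b (h n)) (fun _ => hv _)
  -- This L¹ distance bounds the error in the covered distance at all grid points up to `T` at once.
  let ε : ℕ → ℝ := fun n => ∫ u in (0 : ℝ)..T, |gridSpeed v b (h n) u - pathSpeed v b u|
  have hεint (n : ℕ) (s t : ℝ) : IntervalIntegrable
      (fun u => |gridSpeed v b (h n) u - pathSpeed v b u|) volume s t :=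
    ((hgint n s t).sub (hint s t)).abs
  have hε0 (n : ℕ) : 0 ≤ ε n :=
    intervalIntegral.integral_nonneg T.2 fun _ _ => abs_nonneg _
  have hε : Tendsto ε atTop (𝓝 0) := by
    have := intervalIntegral.tendsto_integral_filter_of_dominated_convergence (μ := volume)
      (a := 0) (b := (T : ℝ)) (l := atTop) (f := fun _ => (0 : ℝ))
      (F := fun n u => |gridSpeed v b (h n) u - pathSpeed v b u|) (fun _ => M - m)
      (Eventually.of_forall fun n =>
        ((measurable_gridSpeed v b (h n)).sub hmeas).abs.aestronglyMeasurable)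
      (Eventually.of_forall fun n => Eventually.of_forall fun u _ => by
        rw [Real.norm_eq_abs, abs_abs]
        exact abs_sub_le_of_le_of_le (hv _).1 (hv _).2 (hv _).1 (hv _).2)
      intervalIntegrable_const
      (Eventually.of_forall fun u _ => by
        have := ((tendsto_gridSpeed v hb hpos hlim u).sub_const (pathSpeed v b u)).abs
        simpa using this)
    simpa using this
  have hlimR : Tendsto (fun n => (h n : ℝ)) atTop (𝓝 0) := by
    exact_mod_cast (NNReal.continuous_coe.tendsto 0).comp hlim
  have hbound : Tendsto (fun n => (ε n + h n * M) / m + h n) atTop (𝓝 0) := by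
    have := ((hε.add (hlimR.mul_const M)).div_const m).add hlimR
    simpa using this
  rw [tendsto_iff_norm_sub_tendsto_zero]
  refine squeeze_zero (fun _ => norm_nonneg _) (fun n => ?_) hbound
  have hnT : ((n + 1 : ℕ) : ℝ) * h n = T := by
    simp only [h]
    push_cast
    field_simp
  have hcoe : (h n : ℝ) = T / (n + 1 : ℕ) := by simp [h]
  have key := abs_mul_card_filter_sub_le (D := fun t => ∫ u in (0 : ℝ)..t, pathSpeed v b u)
    (x := gridDistance v (h n) (fun i => b (i * h n))) (n := n + 1) (h := h n) (τ := τ) (d := d)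
    hm hM (NNReal.coe_pos.2 (hpos n)) (hε0 n)
    (fun s t _ hst => mul_sub_le_integral_sub hmeas hmem hst) hleast.1.1
    (by rw [hnT]; exact hle.trans hdT) heq (fun k hk => by
      rw [← integral_gridSpeed hv b (hpos n) k,
        ← intervalIntegral.integral_sub (hgint n _ _) (hint _ _)]
      have hk0 : (0 : ℝ) ≤ k * h n := by positivity
      have hkT : (k * h n : ℝ) ≤ T := by
        rw [← hnT]
        gcongr
      exact (intervalIntegral.abs_integral_le_integral_abs hk0).trans
        (intervalIntegral.integral_mono_interval le_rfl hk0 hkT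
          (Eventually.of_forall fun _ => abs_nonneg _) (hεint n _ _)))
  rw [Real.norm_eq_abs, ← hcoe]
  exact key

end RightContinuous

/-! ### The candidate for the expected travel time -/

section BlockMatrix

variable {S : Type*} [Fintype S] [DecidableEq S] (Q : Matrix S S ℝ) (v : S → ℝ)

/-- The solution of `V f' = Q f + 𝟏`, `f 0 = 0`. -/
noncomputable def expectedTime (s : S) (x : ℝ) : ℝ :=
  NormedSpace.exp (blockMatrix Q v x) (Sum.inl s) (Sum.inr ())

theorem blockMatrix_eq_smul (d : ℝ) : blockMatrix Q v d = d • blockMatrix Q v 1 := by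
  simp [blockMatrix, Matrix.fromBlocks_smul]

theorem blockMatrix_inl_inl {v : S → ℝ} (hv : ∀ s, v s ≠ 0) (s y : S) :
    blockMatrix Q v 1 (Sum.inl s) (Sum.inl y) = (v s)⁻¹ * Q s y := by
  have hu : IsUnit v := Pi.isUnit_iff.2 fun s => (hv s).isUnit
  simp [blockMatrix, Matrix.inv_diagonal, Matrix.diagonal_mul, Ring.inverse, hu]

theorem blockMatrix_inl_inr {v : S → ℝ} (hv : ∀ s, v s ≠ 0) (s : S) :
    blockMatrix Q v 1 (Sum.inl s) (Sum.inr ()) = (v s)⁻¹ := by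
  have hu : IsUnit v := Pi.isUnit_iff.2 fun s => (hv s).isUnit
  simp [blockMatrix, Matrix.inv_diagonal, Matrix.diagonal_mul, Ring.inverse, hu]

theorem blockMatrix_inr (d : ℝ) (i : S ⊕ Unit) : blockMatrix Q v d (Sum.inr ()) i = 0 := by
  cases i <;> simp [blockMatrix]

/-- The bottom row of the block matrix vanishes, so this entry has derivative zero. -/
theorem exp_smul_blockMatrix_inr_inr (x : ℝ) :
    NormedSpace.exp (x • blockMatrix Q v 1) (Sum.inr ()) (Sum.inr ()) = 1 := by
  have hderiv (t : ℝ) := hasDerivAt_exp_smul_apply (blockMatrix Q v 1) (Sum.inr ()) (Sum.inr ()) t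
  have h0 (t : ℝ) : (blockMatrix Q v 1 * NormedSpace.exp (t • blockMatrix Q v 1))
      (Sum.inr ()) (Sum.inr ()) = 0 := by
    simp [Matrix.mul_apply, blockMatrix_inr]
  simp only [h0] at hderiv
  have := is_const_of_deriv_eq_zero (fun u => (hderiv u).differentiableAt)
    (fun u => (hderiv u).deriv) x 0
  simpa using this

theorem exp_blockMatrix_mulVec (d : ℝ) :
    NormedSpace.exp (blockMatrix Q v d) *ᵥ Sum.elim (fun _ => 0) (fun _ => 1) =
      Sum.elim (fun s => expectedTime Q v s d) (fun _ => 1) := by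
  ext i
  cases i with
  | inl s => simp [Matrix.mulVec, dotProduct, expectedTime]
  | inr u =>
    have := exp_smul_blockMatrix_inr_inr Q v d
    rw [← blockMatrix_eq_smul] at this
    simpa [Matrix.mulVec, dotProduct] using this

theorem expectedTime_zero (s : S) : expectedTime Q v s 0 = 0 := by
  simp [expectedTime, blockMatrix_eq_smul Q v 0]

theorem continuous_expectedTime (s : S) : Continuous (expectedTime Q v s) := by
  have h : expectedTime Q v s =
      fun x => NormedSpace.exp (x • blockMatrix Q v 1) (Sum.inl s) (Sum.inr ()) := by
    ext x
    rw [expectedTime, blockMatrix_eq_smul]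
  rw [h]
  exact continuous_iff_continuousAt.2 fun x => (hasDerivAt_exp_smul_apply _ _ _ x).continuousAt

theorem eventually_abs_expectedTime_le {η : ℝ} (hη : 0 < η) :
    ∀ᶠ x in 𝓝 (0 : ℝ), ∀ s, |expectedTime Q v s x| ≤ η := by
  refine eventually_all.2 fun s => ?_
  have := (continuous_expectedTime Q v s).abs.tendsto 0
  rw [expectedTime_zero, abs_zero] at this
  exact this.eventually_le_const hη

theorem exists_abs_expectedTime_le (d : ℝ) :
    ∃ K, 0 ≤ K ∧ ∀ x ∈ Set.Icc 0 d, ∀ s, |expectedTime Q v s x| ≤ K := by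
  have h (s : S) := isCompact_Icc.exists_bound_of_continuousOn (s := Set.Icc 0 d)
    (continuous_expectedTime Q v s).continuousOn
  choose K hK using h
  refine ⟨∑ s, |K s|, Finset.sum_nonneg fun _ _ => abs_nonneg _, fun x hx s => ?_⟩
  exact ((hK s x hx).trans (le_abs_self _)).trans
    (Finset.single_le_sum (f := fun s => |K s|) (fun _ _ => abs_nonneg _) (Finset.mem_univ s))

/-- Second-order expansion of `expectedTime` backwards from `x`, uniform in `x ∈ [0, d]`. -/
theorem exists_eventually_abs_expectedTime_sub_le {v : S → ℝ} (hv : ∀ s, 0 < v s) (d : ℝ) :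
    ∃ C, 0 ≤ C ∧ ∀ᶠ h in 𝓝 (0 : ℝ), ∀ x ∈ Set.Icc 0 d, ∀ s,
      |expectedTime Q v s (x - h * v s) - (expectedTime Q v s x -
        h * (∑ y, Q s y * expectedTime Q v y x + 1))| ≤ C * h ^ 2 := by
  obtain ⟨C, hC, hexp⟩ := exists_eventually_abs_exp_smul_sub_le (blockMatrix Q v 1)
  obtain ⟨K, hK, hKx⟩ := exists_abs_expectedTime_le Q v d
  have key (s : S) : ∀ᶠ h in 𝓝 (0 : ℝ), ∀ x ∈ Set.Icc 0 d,
      |expectedTime Q v s (x - h * v s) - (expectedTime Q v s x -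
        h * (∑ y, Q s y * expectedTime Q v y x + 1))| ≤
      ((Fintype.card S * K + 1) * C * v s ^ 2) * h ^ 2 := by
    have hlim : Tendsto (fun h : ℝ => -(h * v s)) (𝓝 0) (𝓝 0) := by
      have : Continuous fun h : ℝ => -(h * v s) := by fun_prop
      simpa using this.tendsto 0
    filter_upwards [hlim.eventually hexp] with h hh x hx
    set R := fun i => NormedSpace.exp (-(h * v s) • blockMatrix Q v 1) (Sum.inl s) i -
      (1 + -(h * v s) • blockMatrix Q v 1) (Sum.inl s) i with hR
    have hRle (i : S ⊕ Unit) : |R i| ≤ C * (h * v s) ^ 2 := by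
      simpa only [hR, neg_sq] using hh (Sum.inl s) i
    have hexpR (i : S ⊕ Unit) : NormedSpace.exp (-(h * v s) • blockMatrix Q v 1) (Sum.inl s) i =
        (1 + -(h * v s) • blockMatrix Q v 1) (Sum.inl s) i + R i := by simp [hR]
    have heq : expectedTime Q v s (x - h * v s) - (expectedTime Q v s x -
        h * (∑ y, Q s y * expectedTime Q v y x + 1)) =
        ∑ y, R (Sum.inl y) * expectedTime Q v y x + R (Sum.inr ()) := by
      -- Only the factor for `-(h * v s)` is expanded; in its row `s`, the factor `v s` cancels the
      -- entry of `V⁻¹`.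
      rw [expectedTime, blockMatrix_eq_smul, show x - h * v s = -(h * v s) + x by ring,
        exp_add_smul, Matrix.mul_apply, Fintype.sum_sum_type]
      simp only [hexpR, Finset.univ_unique, PUnit.default_eq_unit, Finset.sum_singleton,
        exp_smul_blockMatrix_inr_inr, mul_one]
      have hφ (y : S) : NormedSpace.exp (x • blockMatrix Q v 1) (Sum.inl y) (Sum.inr ()) =
          expectedTime Q v y x := by rw [expectedTime, blockMatrix_eq_smul Q v x]
      simp only [hφ, Matrix.add_apply, Matrix.smul_apply, smul_eq_mul, Matrix.one_apply,
        Sum.inl.injEq, blockMatrix_inl_inl Q fun s => (hv s).ne',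
        blockMatrix_inl_inr Q fun s => (hv s).ne', add_mul, Finset.sum_add_distrib, ite_mul,
        one_mul, zero_mul, Finset.sum_ite_eq, Finset.mem_univ, if_true, reduceCtorEq, if_false]
      have hs := (hv s).ne'
      have h1 : ∑ y, -(h * v s) * ((v s)⁻¹ * Q s y) * expectedTime Q v y x =
          -(h * ∑ y, Q s y * expectedTime Q v y x) := by
        rw [Finset.mul_sum, ← Finset.sum_neg_distrib]
        refine Finset.sum_congr rfl fun y _ => ?_
        field_simp
      rw [h1]
      field_simp
      ring
    rw [heq]
    calc _ ≤ ∑ y, |R (Sum.inl y) * expectedTime Q v y x| + |R (Sum.inr ())| :=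
          (abs_add_le _ _).trans (by gcongr; exact Finset.abs_sum_le_sum_abs _ _)
      _ ≤ ∑ _y : S, C * (h * v s) ^ 2 * K + C * (h * v s) ^ 2 := by
          gcongr with y
          · rw [abs_mul]
            exact mul_le_mul (hRle _) (hKx x hx y) (abs_nonneg _) (by positivity)
          · exact hRle _
      _ = _ := by
          rw [Finset.sum_const, nsmul_eq_mul, Finset.card_univ]
          ring
  have hnonneg (s : S) : 0 ≤ (Fintype.card S * K + 1) * C * v s ^ 2 := by positivity
  refine ⟨∑ s, (Fintype.card S * K + 1) * C * v s ^ 2,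
    Finset.sum_nonneg fun s _ => hnonneg s, ?_⟩
  filter_upwards [eventually_all.2 key] with h hh x hx s
  refine (hh s x hx).trans ?_
  gcongr
  exact Finset.single_le_sum (f := fun s => (Fintype.card S * K + 1) * C * v s ^ 2)
    (fun s _ => hnonneg s) (Finset.mem_univ s)

/-- One step of the chain with mesh `h` changes `expectedTime` of the remaining distance plus the
elapsed time by `O(h ^ 2)` in expectation. -/
theorem exists_eventually_abs_sum_exp_mul_le {Q : Matrix S S ℝ} (hQ : ∀ s, ∑ y, Q s y = 0)
    {v : S → ℝ} (hv : ∀ s, 0 < v s) (d : ℝ) :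
    ∃ C, 0 ≤ C ∧ ∀ᶠ h in 𝓝[>] (0 : ℝ), ∀ x ∈ Set.Icc 0 d, ∀ s,
      |∑ y, NormedSpace.exp (h • Q) s y *
        (h + expectedTime Q v y (x - h * v y) - expectedTime Q v s x)| ≤ C * h ^ 2 := by
  obtain ⟨C₁, hC₁, hexp⟩ := exists_eventually_abs_exp_smul_sub_le Q
  obtain ⟨C₂, hC₂, hstep⟩ := exists_eventually_abs_expectedTime_sub_le Q hv d
  obtain ⟨K, hK, hKx⟩ := exists_abs_expectedTime_le Q v d
  obtain ⟨q, hq, hQq⟩ : ∃ q, 0 ≤ q ∧ ∀ s, ∑ y, |Q s y| ≤ q := by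
    refine ⟨∑ s, ∑ y, |Q s y|, by positivity, fun s => ?_⟩
    exact Finset.single_le_sum (f := fun s => ∑ y, |Q s y|) (fun _ _ => by positivity)
      (Finset.mem_univ s)
  obtain ⟨c, hc⟩ : ∃ c : ℝ, c = Fintype.card S := ⟨_, rfl⟩
  have hc0 : 0 ≤ c := hc ▸ Nat.cast_nonneg _
  -- The three terms bound, in order, the summands of `hsum` below: the expansion error at `s`, the
  -- second-order part of `h • Q`, and the remainder of the exponential.
  refine ⟨C₂ + q * (q * K + C₂) + c * C₁ * (2 * K + q * K + C₂), by positivity, ?_⟩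
  filter_upwards [nhdsWithin_le_nhds hexp, nhdsWithin_le_nhds hstep,
    Ioo_mem_nhdsGT (zero_lt_one' ℝ)] with h hexp hstep hh x hx s
  have hh0 := hh.1
  have hh1 := hh.2.le
  have hhh : h ^ 2 ≤ h := by nlinarith
  set f := fun y => expectedTime Q v y x with hf
  set Qf := fun y => ∑ z, Q y z * f z with hQf
  have hQfK (y : S) : |Qf y| ≤ q * K := by
    calc _ ≤ ∑ z, |Q y z * f z| := Finset.abs_sum_le_sum_abs _ _
      _ ≤ ∑ z, |Q y z| * K := by
        gcongr with z
        rw [abs_mul]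
        gcongr
        exact hKx x hx z
      _ ≤ q * K := by
        rw [← Finset.sum_mul]
        gcongr
        exact hQq y
  set r := fun y => expectedTime Q v y (x - h * v y) - (f y - h * (Qf y + 1)) with hr
  have hrle (y : S) : |r y| ≤ C₂ * h ^ 2 := hstep x hx y
  set g := fun y => h + expectedTime Q v y (x - h * v y) - f s with hg
  have hgr (y : S) : g y = f y - f s - h * Qf y + r y := by simp only [hg, hr]; ring
  have hgle (y : S) : |g y| ≤ 2 * K + q * K + C₂ := by
    have h1 : |h * Qf y| ≤ q * K := by
      rw [abs_mul, abs_of_pos hh0]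
      calc h * |Qf y| ≤ 1 * (q * K) := by gcongr; exact hQfK y
        _ = _ := one_mul _
    have h2 : |r y| ≤ C₂ := (hrle y).trans (by nlinarith)
    have h3 := hKx x hx y
    have h4 := hKx x hx s
    rw [hgr]
    rw [abs_le] at *
    constructor <;> linarith
  set R := fun y => NormedSpace.exp (h • Q) s y - (1 + h • Q) s y with hR
  have hexpR (y : S) : NormedSpace.exp (h • Q) s y = (1 + h • Q) s y + R y := by simp [hR]
  have hsum : ∑ y, NormedSpace.exp (h • Q) s y * g y =
      r s + h * ∑ y, Q s y * (r y - h * Qf y) + ∑ y, R y * g y := by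
    simp only [hexpR, add_mul, Finset.sum_add_distrib, Matrix.add_apply, Matrix.one_apply, ite_mul,
      one_mul, zero_mul, Finset.sum_ite_eq, Finset.mem_univ, if_true, Matrix.smul_apply,
      smul_eq_mul]
    -- The term `h * Qf s` produced here cancels `-h * Qf s` from `g s`, so no first-order term
    -- survives.
    have h1 : ∑ y, h * Q s y * g y =
        h * (Qf s - (∑ y, Q s y) * f s + ∑ y, Q s y * (r y - h * Qf y)) := by
      rw [hQf, Finset.sum_mul, ← Finset.sum_sub_distrib, ← Finset.sum_add_distrib, Finset.mul_sum]
      refine Finset.sum_congr rfl fun y _ => ?_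
      rw [hgr]
      ring
    rw [h1, hQ, hgr]
    ring
  rw [hsum]
  have hb1 : |h * ∑ y, Q s y * (r y - h * Qf y)| ≤ q * (q * K + C₂) * h ^ 2 := by
    rw [abs_mul, abs_of_pos hh0]
    calc h * |∑ y, Q s y * (r y - h * Qf y)|
        ≤ h * ∑ y, |Q s y * (r y - h * Qf y)| := by
          gcongr; exact Finset.abs_sum_le_sum_abs _ _
      _ ≤ h * ∑ y, |Q s y| * ((q * K + C₂) * h) := by
          gcongr with y
          rw [abs_mul]
          gcongr
          calc |r y - h * Qf y| ≤ |r y| + |h * Qf y| := abs_sub _ _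
            _ ≤ C₂ * h + h * (q * K) := by
              rw [abs_mul, abs_of_pos hh0]
              gcongr
              · exact (hrle y).trans (by gcongr)
              · exact hQfK y
            _ = _ := by ring
      _ ≤ h * (q * ((q * K + C₂) * h)) := by
          rw [← Finset.sum_mul]
          gcongr
          exact hQq s
      _ = _ := by ring
  have hb2 : |∑ y, R y * g y| ≤ c * C₁ * (2 * K + q * K + C₂) * h ^ 2 := by
    calc _ ≤ ∑ y, |R y * g y| := Finset.abs_sum_le_sum_abs _ _
      _ ≤ ∑ _y : S, C₁ * h ^ 2 * (2 * K + q * K + C₂) := by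
          gcongr with y
          rw [abs_mul]
          exact mul_le_mul (hexp s y) (hgle y) (abs_nonneg _) (by positivity)
      _ = _ := by
          rw [Finset.sum_const, nsmul_eq_mul, Finset.card_univ, ← hc]
          ring
  calc _ ≤ |r s| + |h * ∑ y, Q s y * (r y - h * Qf y)| + |∑ y, R y * g y| := abs_add_three _ _ _
    _ ≤ C₂ * h ^ 2 + q * (q * K + C₂) * h ^ 2 + c * C₁ * (2 * K + q * K + C₂) * h ^ 2 := by
      gcongr
      exact hrle s
    _ = _ := by ring

end BlockMatrix

/-! ### Telescoping along the grid -/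

section Telescoping

variable {S : Type*} {v : S → ℝ} {m M : ℝ}

/-- The change, in step `k`, of `φ` of the remaining distance plus the elapsed time, as long as the
destination cannot be reached within the step. -/
noncomputable def gridIncrement (φ : S → ℝ → ℝ) (v : S → ℝ) (M d h : ℝ) (c : ℕ → S) (k : ℕ) : ℝ :=
  if gridDistance v h c k ≤ d - h * M then
    h + φ (c (k + 1)) (d - gridDistance v h c (k + 1)) - φ (c k) (d - gridDistance v h c k)
  else 0

theorem gridDistance_succ (v : S → ℝ) (h : ℝ) (c : ℕ → S) (k : ℕ) :
    gridDistance v h c (k + 1) = gridDistance v h c k + h * v (c (k + 1)) :=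
  Finset.sum_range_succ _ _

theorem mul_le_gridDistance (hv : ∀ s, v s ∈ Set.Icc m M) {h : ℝ} (hh : 0 ≤ h) (c : ℕ → S)
    (k : ℕ) : k * (h * m) ≤ gridDistance v h c k := by
  rw [gridDistance, ← nsmul_eq_mul, ← Finset.card_range k, ← Finset.sum_const, Finset.card_range]
  exact Finset.sum_le_sum fun j _ => mul_le_mul_of_nonneg_left (hv _).1 hh

theorem gridCount_zero (v : S → ℝ) (M d h : ℝ) (c : ℕ → S) : gridCount v M d 0 h c = 0 := by
  simp [gridCount]

theorem gridCount_succ (v : S → ℝ) (M d h : ℝ) (c : ℕ → S) (n : ℕ) :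
    gridCount v M d (n + 1) h c =
      gridCount v M d n h c + if gridDistance v h c n ≤ d - h * M then 1 else 0 := by
  rw [gridCount, gridCount, Finset.range_add_one, Finset.filter_insert]
  split_ifs with hn
  · rw [Finset.card_insert_of_notMem (by simp)]
  · rfl

/-- The increments telescope until the remaining distance first drops below `h * M`, and vanish
afterwards. A step covers at most `h * M`, so the drop does not overshoot zero, and `φ` is at most
`η` there in absolute value. -/
theorem abs_sum_gridIncrement_sub_le {φ : S → ℝ → ℝ} (hm : 0 < m) (hv : ∀ s, v s ∈ Set.Icc m M)
    {d h η : ℝ} (hd : 0 ≤ d) (hh : 0 < h) (hφ : ∀ x ∈ Set.Icc 0 (h * M), ∀ s, |φ s x| ≤ η)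
    (c : ℕ → S) {n : ℕ} (hn : d ≤ n * (h * m)) :
    |∑ k ∈ Finset.range n, gridIncrement φ v M d h c k -
      (h * gridCount v M d n h c - φ (c 0) d)| ≤ η := by
  have hM : 0 < M := hm.trans_le ((hv (c 0)).1.trans (hv (c 0)).2)
  have hhM : 0 < h * M := mul_pos hh hM
  have key (n : ℕ) :
      (gridDistance v h c n ≤ d - h * M ∧ ∑ k ∈ Finset.range n, gridIncrement φ v M d h c k =
        h * gridCount v M d n h c + φ (c n) (d - gridDistance v h c n) - φ (c 0) d) ∨
      (d - h * M < gridDistance v h c n ∧ |∑ k ∈ Finset.range n, gridIncrement φ v M d h c k -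
        (h * gridCount v M d n h c - φ (c 0) d)| ≤ η) := by
    induction n with
    | zero =>
      simp only [gridDistance, gridCount_zero, Finset.range_zero, Finset.sum_empty, Nat.cast_zero,
        mul_zero, sub_zero, zero_add, zero_sub, neg_neg]
      rcases le_or_gt 0 (d - h * M) with h0 | h0
      · exact Or.inl ⟨h0, by ring⟩
      · exact Or.inr ⟨h0, hφ d ⟨hd, by linarith⟩ _⟩
    | succ n ih =>
      rw [Finset.sum_range_succ, gridCount_succ, gridIncrement]
      have hvn := hv (c (n + 1))
      rcases ih with ⟨hle, heq⟩ | ⟨hlt, hη⟩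
      · simp only [if_pos hle, heq]
        have h1 : h * v (c (n + 1)) ≤ h * M := mul_le_mul_of_nonneg_left hvn.2 hh.le
        push_cast
        rcases le_or_gt (gridDistance v h c (n + 1)) (d - h * M) with h0 | h0
        · exact Or.inl ⟨h0, by ring⟩
        · refine Or.inr ⟨h0, ?_⟩
          have := hφ (d - gridDistance v h c (n + 1))
            ⟨by rw [gridDistance_succ]; linarith, by linarith⟩ (c (n + 1))
          convert this using 2
          ring
      · simp only [if_neg hlt.not_ge, add_zero]
        refine Or.inr ⟨?_, hη⟩
        have := mul_nonneg hh.le (hm.le.trans hvn.1)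
        rw [gridDistance_succ]
        linarith
  -- By `hn`, `n` steps at speed at least `m` cover `d`, which excludes the first alternative.
  rcases key n with ⟨hle, -⟩ | ⟨-, hη⟩
  · have := mul_le_gridDistance hv hh.le c n
    linarith
  · exact hη

theorem gridDistance_congr (v : S → ℝ) (h : ℝ) {c c' : ℕ → S} {k : ℕ} (hc : ∀ i ≤ k, c i = c' i) :
    gridDistance v h c k = gridDistance v h c' k :=
  Finset.sum_congr rfl fun j hj => by rw [hc _ (Finset.mem_range.1 hj)]

theorem gridCount_congr (v : S → ℝ) (M d h : ℝ) {c c' : ℕ → S} {n : ℕ} (hc : ∀ i ≤ n, c i = c' i) :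
    gridCount v M d n h c = gridCount v M d n h c' := by
  rw [gridCount, gridCount, Finset.filter_congr fun k hk => by
    rw [gridDistance_congr v h fun i hi => hc i (hi.trans (Finset.mem_range.1 hk).le)]]

theorem gridIncrement_congr (φ : S → ℝ → ℝ) (v : S → ℝ) (M d h : ℝ) {c c' : ℕ → S} {k : ℕ}
    (hc : ∀ i ≤ k + 1, c i = c' i) :
    gridIncrement φ v M d h c k = gridIncrement φ v M d h c' k := by
  rw [gridIncrement, gridIncrement, gridDistance_congr v h hc, hc k (by omega), hc (k + 1) le_rfl,
    gridDistance_congr v h fun i hi => hc i (by omega)]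

end Telescoping

/-! ### Finite histories as infinite paths -/

section ExtendPath

variable {S : Type*}

/-- The path that follows `c` and then stays in its last state. -/
def extendPath {k : ℕ} (c : Fin (k + 1) → S) (i : ℕ) : S := c ⟨min i k, by omega⟩

theorem extendPath_of_le {k : ℕ} (c : ℕ → S) {i : ℕ} (hi : i ≤ k) :
    extendPath (fun j : Fin (k + 1) => c j) i = c i := by
  simp [extendPath, hi]

end ExtendPath

/-! ### Expectations over the discrete skeleton -/

section Skeleton

variable {Ω S : Type*} [MeasurableSpace Ω] [Fintype S] [MeasurableSpace S]
  [MeasurableSingletonClass S] {P : Measure Ω}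

/-- The integrand factors through the first `k + 1` states, a random variable with finitely many
values. -/
theorem integrable_of_dependsOn_le [IsFiniteMeasure P] {Y : ℕ → Ω → S} (hY : ∀ i, Measurable (Y i))
    {F : (ℕ → S) → ℝ} {k : ℕ} (hF : ∀ c c', (∀ i ≤ k, c i = c' i) → F c = F c') :
    Integrable (fun ω => F fun i => Y i ω) P := by
  have hZ : Measurable fun ω => fun j : Fin (k + 1) => Y j ω :=
    measurable_pi_iff.2 fun j => hY j
  have h := (Integrable.of_finite (μ := P.map fun ω => fun j : Fin (k + 1) => Y j ω)
    (f := fun c => F (extendPath c))).comp_measurable hZ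
  refine h.congr (Eventually.of_forall fun ω => ?_)
  exact hF _ _ fun i hi => extendPath_of_le (fun i => Y i ω) hi

variable [DecidableEq S]

/-- The Markov property at the times `t 0 ≤ t 1 ≤ …`, in the form of a bound on expectations. -/
theorem IsMarkovProcess.abs_integral_le [IsProbabilityMeasure P] {Q : Matrix S S ℝ}
    {X : ℝ≥0 → Ω → S} (hX : IsMarkovProcess Q X P) {t : ℕ → ℝ≥0} (ht : Monotone t) (k : ℕ)
    {g : (ℕ → S) → S → ℝ} (hg : ∀ c c', (∀ i ≤ k, c i = c' i) → g c = g c') {ε : ℝ}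
    (hε : ∀ c : ℕ → S,
      |∑ y, NormedSpace.exp (((t (k + 1) : ℝ) - t k) • Q) (c k) y * g c y| ≤ ε) :
    |∫ ω, g (fun i => X (t i) ω) (X (t (k + 1)) ω) ∂P| ≤ ε := by
  have hpre : Measurable fun ω => fun j : Fin (k + 1) => X (t j) ω :=
    measurable_pi_iff.2 fun j => hX.measurable _
  have hZ := hpre.prodMk (hX.measurable (t (k + 1)))
  have hprob (c : Fin (k + 1) → S) (y : S) :
      (P.map fun ω => (fun j : Fin (k + 1) => X (t j) ω, X (t (k + 1)) ω)).real {(c, y)} =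
      (P.map fun ω => fun j : Fin (k + 1) => X (t j) ω).real {c} *
        NormedSpace.exp (((t (k + 1) : ℝ) - t k) • Q) (extendPath c k) y := by
    rw [map_measureReal_apply hZ (measurableSet_singleton _),
      map_measureReal_apply hpre (measurableSet_singleton _)]
    have hm := hX.markov k t (fun i => if i ≤ k then extendPath c i else y) ht
    rw [if_pos le_rfl, if_neg (by omega)] at hm
    have hc (ω : Ω) : (∀ i ≤ k, X (t i) ω = extendPath c i) ↔
        (fun j : Fin (k + 1) => X (t j) ω) = c := by
      constructor
      · intro h
        ext j
        rw [h j (by omega), extendPath]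
        congr
        omega
      · rintro rfl i hi
        exact (extendPath_of_le (fun i => X (t i) ω) hi).symm
    convert hm using 2
    · ext ω
      simp only [Set.mem_preimage, Set.mem_singleton_iff, Prod.mk.injEq, ← hc, Set.mem_ofPred_eq]
      constructor
      · rintro ⟨h1, h2⟩ i hi
        split_ifs with hik
        · exact h1 i hik
        · rw [show i = k + 1 by omega, h2]
      · intro h
        refine ⟨fun i hi => by simpa [hi] using h i (by omega), by simpa using h (k + 1) le_rfl⟩
    · congr 1
      ext ω
      simp only [Set.mem_preimage, Set.mem_singleton_iff, ← hc, Set.mem_ofPred_eq]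
      refine forall₂_congr fun i hi => by rw [if_pos hi]
  -- The expectation becomes an average over histories `c` of the conditional sums bounded in `hε`.
  have hint : ∫ ω, g (fun i => X (t i) ω) (X (t (k + 1)) ω) ∂P =
      ∑ c : Fin (k + 1) → S, (P.map fun ω => fun j : Fin (k + 1) => X (t j) ω).real {c} *
        ∑ y, NormedSpace.exp (((t (k + 1) : ℝ) - t k) • Q) (extendPath c k) y *
          g (extendPath c) y := by
    have h1 := integral_map (μ := P) hZ.aemeasurable
      (f := fun z : (Fin (k + 1) → S) × S => g (extendPath z.1) z.2)
      (measurable_of_countable _).aestronglyMeasurable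
    have h2 (ω : Ω) : g (extendPath fun j : Fin (k + 1) => X (t j) ω) = g fun i => X (t i) ω :=
      hg _ _ fun i hi => extendPath_of_le (fun i => X (t i) ω) hi
    simp only [h2] at h1
    rw [← h1, integral_fintype Integrable.of_finite, Fintype.sum_prod_type]
    refine Finset.sum_congr rfl fun c _ => ?_
    rw [Finset.mul_sum]
    refine Finset.sum_congr rfl fun y _ => ?_
    rw [hprob, smul_eq_mul, mul_assoc]
  have htot : ∑ c : Fin (k + 1) → S,
      (P.map fun ω => fun j : Fin (k + 1) => X (t j) ω).real {c} = 1 := by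
    have := Measure.isProbabilityMeasure_map (μ := P) hpre.aemeasurable
    simp
  rw [hint]
  calc _ ≤ ∑ c : Fin (k + 1) → S, (P.map fun ω => fun j : Fin (k + 1) => X (t j) ω).real {c} * ε := by
        refine (Finset.abs_sum_le_sum_abs _ _).trans (Finset.sum_le_sum fun c _ => ?_)
        rw [abs_mul, abs_of_nonneg measureReal_nonneg]
        exact mul_le_mul_of_nonneg_left (hε _) measureReal_nonneg
    _ = ε := by rw [← Finset.sum_mul, htot, one_mul]

end Skeleton

/-! ### Expected travel time under a Markov process -/

section TravelTime

variable {Ω S : Type*} [MeasurableSpace Ω] [Fintype S] [DecidableEq S] [MeasurableSpace S]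
  [MeasurableSingletonClass S] {P : Measure Ω} [IsProbabilityMeasure P]

variable {Q : Matrix S S ℝ} {B : ℝ≥0 → Ω → S} {v : S → ℝ} {m M d : ℝ}

/-- Whether step `k` counts is decided by the history up to `k`, so conditioning on it leaves the
one-step sum in `hε`, with remaining distance in `[0, d]`. -/
theorem IsMarkovProcess.abs_integral_gridIncrement_le (hB : IsMarkovProcess Q B P) (hm : 0 < m)
    (hv : ∀ s, v s ∈ Set.Icc m M) {h : ℝ≥0} (hh : 0 < h) {ε : ℝ} (hε0 : 0 ≤ ε)
    (hε : ∀ x ∈ Set.Icc 0 d, ∀ s, |∑ y, NormedSpace.exp ((h : ℝ) • Q) s y *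
      (h + expectedTime Q v y (x - h * v y) - expectedTime Q v s x)| ≤ ε) (k : ℕ) :
    |∫ ω, gridIncrement (expectedTime Q v) v M d h (fun i => B (i * h) ω) k ∂P| ≤ ε := by
  let g : (ℕ → S) → S → ℝ := fun c y =>
    if gridDistance v h c k ≤ d - h * M then
      h + expectedTime Q v y (d - gridDistance v h c k - h * v y) -
        expectedTime Q v (c k) (d - gridDistance v h c k)
    else 0
  have hg (c c' : ℕ → S) (hc : ∀ i ≤ k, c i = c' i) : g c = g c' := by
    simp only [g, gridDistance_congr v h hc, hc k le_rfl]
  have ht : Monotone fun i : ℕ => (i * h : ℝ≥0) := fun i j hij => by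
    dsimp only
    gcongr
  have key := hB.abs_integral_le ht k hg (ε := ε) fun c => by
    have hstep : ((((k + 1 : ℕ) * h : ℝ≥0) : ℝ) - ((k * h : ℝ≥0) : ℝ)) = h := by
      push_cast
      ring
    rw [hstep]
    by_cases hc : gridDistance v h c k ≤ d - h * M
    · simp only [g, if_pos hc]
      have hM : 0 ≤ M := hm.le.trans ((hv (c 0)).1.trans (hv (c 0)).2)
      have h1 : 0 ≤ h * M := by positivity
      have h2 := mul_le_gridDistance hv h.coe_nonneg c k
      have h3 : 0 ≤ (k : ℝ) * (h * m) := by positivity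
      exact hε _ ⟨by linarith, by linarith⟩ _
    · simpa [g, if_neg hc] using hε0
  convert key using 4 with ω
  rw [gridIncrement]
  simp only [g, gridDistance_succ, sub_sub]

/-- There are `T / h` steps with mean error `C * h ^ 2` each, in total `T * C * h`; the undershoot
at the end is controlled by continuity of `expectedTime` at distance zero. -/
theorem IsMarkovProcess.tendsto_integral_mul_gridCount (hB : IsMarkovProcess Q B P) {s : S}
    (hs : ∀ᵐ ω ∂P, B 0 ω = s) (hm : 0 < m) (hv : ∀ s, v s ∈ Set.Icc m M) (hd : 0 ≤ d) {T : ℝ≥0}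
    (hT : 0 < T) (hdT : d / m ≤ T) :
    Tendsto (fun n : ℕ => ∫ ω, (T / (n + 1 : ℕ) : ℝ) * gridCount v M d (n + 1) (T / (n + 1 : ℕ))
      (fun i => B (i * (T / (n + 1 : ℕ))) ω) ∂P) atTop (𝓝 (expectedTime Q v s d)) := by
  obtain ⟨C, hC, hstep⟩ := exists_eventually_abs_sum_exp_mul_le hB.rate.row_sum
    (fun s => hm.trans_le (hv s).1) d
  let h : ℕ → ℝ≥0 := fun n => T / (n + 1 : ℕ)
  have hpos (n : ℕ) : 0 < h n := by positivity
  have hcoe (n : ℕ) : (h n : ℝ) = T / (n + 1 : ℕ) := by simp [h]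
  have hlim : Tendsto (fun n => (h n : ℝ)) atTop (𝓝 0) := by
    simp only [hcoe]
    exact (tendsto_const_div_atTop_nhds_zero_nat (T : ℝ)).comp (tendsto_add_atTop_nat 1)
  have hlimpos : Tendsto (fun n => (h n : ℝ)) atTop (𝓝[>] 0) :=
    tendsto_nhdsWithin_iff.2 ⟨hlim, Eventually.of_forall fun n => NNReal.coe_pos.2 (hpos n)⟩
  have hM : 0 ≤ M := hm.le.trans ((hv s).1.trans (hv s).2)
  rw [Metric.tendsto_nhds]
  intro η hη
  obtain ⟨δ, hδ, hφ⟩ := Metric.eventually_nhds_iff.1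
    (eventually_abs_expectedTime_le Q v (half_pos (half_pos hη)))
  have hM0 : ∀ᶠ n in atTop, (h n : ℝ) * M < δ :=
    (by simpa using hlim.mul_const M : Tendsto (fun n => (h n : ℝ) * M) atTop (𝓝 0)).eventually_lt_const hδ
  have hC0 : ∀ᶠ n in atTop, T * C * (h n : ℝ) < η / 2 :=
    (by simpa using hlim.const_mul (T * C) :
      Tendsto (fun n => T * C * (h n : ℝ)) atTop (𝓝 0)).eventually_lt_const (half_pos hη)
  filter_upwards [hM0, hC0, hlimpos.eventually hstep] with n hM0 hC0 hstep
  have hnT : ((n + 1 : ℕ) : ℝ) * h n = T := by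
    rw [hcoe]
    field_simp
  simp only [← hcoe]
  change dist (∫ ω, (h n : ℝ) * gridCount v M d (n + 1) (h n) (fun i => B (i * h n) ω) ∂P) _ < η
  have hmeas (i : ℕ) := hB.measurable (i * h n)
  have hcount : Integrable (fun ω => (h n : ℝ) * gridCount v M d (n + 1) (h n)
      (fun i => B (i * h n) ω)) P :=
    integrable_of_dependsOn_le (F := fun c => (h n : ℝ) * gridCount v M d (n + 1) (h n) c)
      (k := n + 1) hmeas fun c c' hc => by
        rw [gridCount_congr v M d (h n) hc]
  have hinc (k : ℕ) : Integrable (fun ω => gridIncrement (expectedTime Q v) v M d (h n)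
      (fun i => B (i * h n) ω) k) P :=
    integrable_of_dependsOn_le
      (F := fun c => gridIncrement (expectedTime Q v) v M d (h n) c k) (k := k + 1) hmeas
      fun c c' hc => gridIncrement_congr _ v M d (h n) hc
  have hsum : Integrable (fun ω => ∑ k ∈ Finset.range (n + 1),
      gridIncrement (expectedTime Q v) v M d (h n) (fun i => B (i * h n) ω) k) P :=
    integrable_finsetSum _ fun k _ => hinc k
  have h1 : |∫ ω, ∑ k ∈ Finset.range (n + 1),
      gridIncrement (expectedTime Q v) v M d (h n) (fun i => B (i * h n) ω) k ∂P| ≤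
      T * C * h n := by
    rw [integral_finsetSum _ fun k _ => hinc k]
    calc _ ≤ ∑ _k ∈ Finset.range (n + 1), C * (h n : ℝ) ^ 2 :=
          (Finset.abs_sum_le_sum_abs _ _).trans (Finset.sum_le_sum fun k _ =>
            hB.abs_integral_gridIncrement_le hm hv (hpos n) (by positivity) hstep k)
      _ = T * C * h n := by
          rw [Finset.sum_const, nsmul_eq_mul, Finset.card_range, ← hnT]
          ring
  have h2 : |∫ ω, (∑ k ∈ Finset.range (n + 1),
      gridIncrement (expectedTime Q v) v M d (h n) (fun i => B (i * h n) ω) k -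
      ((h n : ℝ) * gridCount v M d (n + 1) (h n) (fun i => B (i * h n) ω) -
        expectedTime Q v s d)) ∂P| ≤ η / 2 / 2 := by
    have := norm_integral_le_of_norm_le_const (μ := P) (C := η / 2 / 2)
      (f := fun ω => (∑ k ∈ Finset.range (n + 1),
        gridIncrement (expectedTime Q v) v M d (h n) (fun i => B (i * h n) ω) k -
        ((h n : ℝ) * gridCount v M d (n + 1) (h n) (fun i => B (i * h n) ω) -
          expectedTime Q v s d))) ?_
    · simpa using this
    · filter_upwards [hs] with ω hω
      have := abs_sum_gridIncrement_sub_le (φ := expectedTime Q v) hm hv hd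
        (NNReal.coe_pos.2 (hpos n)) (η := η / 2 / 2) (fun x hx s => hφ (by
          rw [Real.dist_eq, sub_zero, abs_of_nonneg hx.1]
          exact hx.2.trans_lt hM0) s) (fun i => B (i * h n) ω) (n := n + 1) (by
          rw [← mul_assoc, hnT]
          exact (div_le_iff₀ hm).1 hdT)
      simpa [hω] using this
  have hdiff : Integrable (fun ω => (h n : ℝ) * gridCount v M d (n + 1) (h n)
      (fun i => B (i * h n) ω) - expectedTime Q v s d) P := hcount.sub (integrable_const _)
  rw [integral_sub hsum hdiff, integral_sub hcount (integrable_const _)] at h2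
  simp only [integral_const, probReal_univ, one_smul] at h2
  rw [Real.dist_eq]
  rw [abs_le] at h1 h2
  rw [abs_lt]
  constructor <;> linarith

/-- The expected travel time of a vehicle whose speed is governed by a Markov process. -/
theorem IsMarkovProcess.travelTime_spec (hB : IsMarkovProcess Q B P) {s : S}
    (hs : ∀ᵐ ω ∂P, B 0 ω = s) (hv : ∀ s, 0 < v s) (hd : 0 ≤ d) :
    (∀ᵐ ω ∂P, IsLeast (arrivalTimes v B d ω) (travelTime v B d ω)) ∧
      Integrable (travelTime v B d) P ∧
      ∫ ω, travelTime v B d ω ∂P = expectedTime Q v s d := by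
  have : Nonempty S := ⟨s⟩
  obtain ⟨s₀, hs₀⟩ := Finite.exists_min v
  obtain ⟨s₁, hs₁⟩ := Finite.exists_max v
  have hvm (s : S) : v s ∈ Set.Icc (v s₀) (v s₁) := ⟨hs₀ s, hs₁ s⟩
  have hm := hv s₀
  have hdm : 0 ≤ d / v s₀ := by positivity
  -- Adding `1` keeps the horizon, and thus the mesh, positive when `d = 0`.
  let T : ℝ≥0 := (d / v s₀).toNNReal + 1
  have hT : 0 < T := by positivity
  have hdT : d / v s₀ ≤ T := by
    simp only [T, NNReal.coe_add, Real.coe_toNNReal _ hdm, NNReal.coe_one]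
    linarith
  let F : ℕ → Ω → ℝ := fun n ω => (T / (n + 1 : ℕ) : ℝ) *
    gridCount v (v s₁) d (n + 1) (T / (n + 1 : ℕ)) (fun i => B (i * (T / (n + 1 : ℕ))) ω)
  have hlim : ∀ᵐ ω ∂P, Tendsto (fun n => F n ω) atTop (𝓝 (travelTime v B d ω)) := by
    filter_upwards [hB.right_continuous] with ω hω
    exact tendsto_mul_gridCount hm hvm hω hd hT hdT
  have hF (n : ℕ) : Integrable (F n) P :=
    integrable_of_dependsOn_le (F := fun c => (T / (n + 1 : ℕ) : ℝ) *
      gridCount v (v s₁) d (n + 1) (T / (n + 1 : ℕ)) c) (k := n + 1)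
      (Y := fun i => B (i * (T / (n + 1 : ℕ)))) (fun i => hB.measurable _) fun c c' hc => by
        rw [gridCount_congr v _ d _ hc]
  have hbound (n : ℕ) : ∀ᵐ ω ∂P, ‖F n ω‖ ≤ T := Eventually.of_forall fun ω => by
    rw [Real.norm_eq_abs, abs_of_nonneg (by positivity)]
    have hcard := Finset.card_filter_le (Finset.range (n + 1)) fun k =>
      gridDistance v (T / (n + 1 : ℕ)) (fun i => B (i * (T / (n + 1 : ℕ))) ω) k ≤
        d - T / (n + 1 : ℕ) * v s₁
    rw [Finset.card_range] at hcard
    calc F n ω ≤ (T / (n + 1 : ℕ) : ℝ) * (n + 1 : ℕ) :=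
          mul_le_mul_of_nonneg_left (Nat.cast_le.2 hcard) (by positivity)
      _ = T := div_mul_cancel₀ _ (by positivity)
  have hmeas : AEStronglyMeasurable (travelTime v B d) P :=
    aestronglyMeasurable_of_tendsto_ae atTop (fun n => (hF n).aestronglyMeasurable) hlim
  have hspec : ∀ᵐ ω ∂P, IsLeast (arrivalTimes v B d ω) (travelTime v B d ω) ∧
      travelTime v B d ω ≤ d / v s₀ := by
    filter_upwards [hB.right_continuous] with ω hω
    have := isLeast_travelTime_and_integral_eq hm hvm hω hd
    exact ⟨this.1, this.2.1⟩
  refine ⟨hspec.mono fun ω hω => hω.1, ?_, ?_⟩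
  · refine Integrable.of_bound hmeas (d / v s₀) (hspec.mono fun ω hω => ?_)
    rw [Real.norm_eq_abs, abs_of_nonneg hω.1.1.1]
    exact hω.2
  · exact tendsto_nhds_unique
      (tendsto_integral_of_dominated_convergence (fun _ => (T : ℝ))
        (fun n => (hF n).aestronglyMeasurable) (integrable_const _) hbound hlim)
      (hB.tendsto_integral_mul_gridCount hs hm hvm hd hT hdT)

end TravelTime

/-! ### Passing to the local state -/

section LocalState

variable {N : Type*} [Fintype N] [DecidableEq N] {G : Digraph N} [DecidableRel G.Adj]

theorem localSpeed_localState {n : Arc G → ℕ} {r : ℕ} {e : Arc G} {v : (∀ a, Fin (n a)) → ℝ}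
    (hv : DependsOn v (arcsWithin G r e : Set (Arc G))) (s : ∀ a, Fin (n a)) :
    localSpeed r e v (localState r e s) = v s := by
  have hfactor : Function.FactorsThrough v (localState r e) :=
    fun s s' h => hv fun a ha => congrFun h ⟨a, ha⟩
  exact hfactor.extend_apply 0 s

/-- The given `s` supplies states for the arcs outside the neighbourhood. Surjectivity ensures that
the default value `0` in `localSpeed` never occurs, so local speeds are positive. -/
theorem localState_surjective {n : Arc G → ℕ} (r : ℕ) (e : Arc G) (s : ∀ a, Fin (n a)) :
    Function.Surjective (localState r e : (∀ a, Fin (n a)) → _) := by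
  classical
  intro σ
  refine ⟨fun a => if ha : a ∈ arcsWithin G r e then σ ⟨a, ha⟩ else s a, ?_⟩
  ext a
  simp

end LocalState

end RoadNetwork

open RoadNetwork in
theorem theorem2 {N : Type*} [Fintype N] [DecidableEq N] (G : Digraph N) [DecidableRel G.Adj]
    -- per-arc state spaces and transition rate matrices, and the speed on each arc
    (n : Arc G → ℕ) (Q : ∀ a, Matrix (Fin (n a)) (Fin (n a)) ℝ)
    (v : Arc G → (∀ a, Fin (n a)) → ℝ)
    -- the per-arc processes; `P s` is the law given that the background process starts in `s`
    {Ω : Type*} [MeasurableSpace Ω] (X : ∀ a : Arc G, ℝ≥0 → Ω → Fin (n a))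
    (P : (∀ a, Fin (n a)) → Measure Ω) [∀ s, IsProbabilityMeasure (P s)]
    (hstart : ∀ s, ∀ᵐ ω ∂P s, ∀ a, X a 0 ω = s a)
    (hmarkov : ∀ s a, IsMarkovProcess (Q a) (X a) (P s))
    (hindep : ∀ s, iIndepFun (fun a ω t => X a t ω) (P s))
    -- the arc `kℓ`, positive speeds, local-`r`-correlation
    (e : Arc G) (r : ℕ) (hpos : ∀ s, 0 < v e s)
    (hlocal : DependsOn (v e) (arcsWithin G r e : Set (Arc G)))
    (d : ℝ) (hd : 0 ≤ d) :
    -- `Q_{kℓ}^r` is the transition rate matrix of the local background process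
    (∀ s, IsMarkovProcess (localRateMatrix r e Q)
      (fun t ω => localState r e fun a => X a t ω) (P s)) ∧
    -- the travel time is an attained minimum and has a finite expectation
    (∀ s, ∀ᵐ ω ∂P s, IsLeast (arrivalTimes (v e) (fun t ω a => X a t ω) d ω)
      (travelTime (v e) (fun t ω a => X a t ω) d ω)) ∧
    (∀ s, Integrable (travelTime (v e) (fun t ω a => X a t ω) d) (P s)) ∧
    -- the expected travel times form a vector indexed by the local states, given by the formula
    ∃ Φ : (∀ a : arcsWithin G r e, Fin (n a)) → ℝ,
      (∀ s, ∫ ω, travelTime (v e) (fun t ω a => X a t ω) d ω ∂P s = Φ (localState r e s)) ∧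
      Sum.elim Φ (fun _ => 1) =
        NormedSpace.exp (blockMatrix (localRateMatrix r e Q) (localSpeed r e (v e)) d) *ᵥ
          Sum.elim (fun _ => 0) (fun _ => 1) := by
  have hlocalMarkov (s) : IsMarkovProcess (localRateMatrix r e Q)
      (fun t ω => localState r e fun a => X a t ω) (P s) :=
    isMarkovProcess_kroneckerSum (fun a : arcsWithin G r e => hmarkov s a)
      ((hindep s).precomp (g := Subtype.val) Subtype.val_injective)
  -- By locality, global and local speeds agree along every path, so the travel times coincide
  -- pointwise.
  have harrival : arrivalTimes (v e) (fun t ω a => X a t ω) d =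
      arrivalTimes (localSpeed r e (v e)) (fun t ω => localState r e fun a => X a t ω) d := by
    ext ω t
    simp only [arrivalTimes, localSpeed_localState hlocal]
  have htravel : travelTime (v e) (fun t ω a => X a t ω) d =
      travelTime (localSpeed r e (v e)) (fun t ω => localState r e fun a => X a t ω) d := by
    ext ω
    rw [travelTime, travelTime, harrival]
  have hspec (s) := (hlocalMarkov s).travelTime_spec (v := localSpeed r e (v e)) (d := d)
    (s := localState r e s)
    ((hstart s).mono fun ω hω => funext fun a => hω a)
    (fun σ => by
      obtain ⟨s', rfl⟩ := localState_surjective r e s σ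
      rw [localSpeed_localState hlocal]
      exact hpos s') hd
  rw [harrival, htravel]
  exact ⟨hlocalMarkov, fun s => (hspec s).1, fun s => (hspec s).2.1,
    fun σ => expectedTime (localRateMatrix r e Q) (localSpeed r e (v e)) σ d,
    fun s => (hspec s).2.2, (exp_blockMatrix_mulVec _ _ d).symm⟩
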